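/- All topological spaces are assumed to be Hausdorff and completely regular. A space is countably compact if each of its countable open covers has a finite subcover. A subset $A$ of a space is \emph{countably closed} if $\overline{C}\subseteq A$ for every countable $C\subseteq A$. A \emph{retractional skeleton} in a countably compact space $X$ is a family of continuous retractions $\{r_s\}_{s\in\Gamma}$ of $X$, indexed by a (nonempty) up-directed partially ordered set $\Gamma$, such that (i) $r_s[X]$ is a metrizable compact space for each $s\in\Gamma$; (ii) if $s\le t$ then $r_s=r_t\circ r_s=r_s\circ r_t$; (iii) whenever $s_0\le s_1\le\cdots$ in $\Gamma$, the supremum $t=\sup_n s_n$ exists and $r_t(x)=\lim_{n\to\infty}r_{s_n}(x)$ for every $x\in X$; (iv) $x=\lim_{s\in\Gamma}r_s(x)$ for every $x\in X$. It is \emph{full} if $X=\bigcup_{s\in\Gamma}r_s[X]$. A countably compact space is called a \emph{non-commutative Corson countably compact space} if it has a full retractional skeleton, and a countably compact space $X$ is called a \emph{weakly non-commutative Corson countably compact space} if there is a continuous surjection $f:Y\to X$ from a non-commutative Corson countably compact space $Y$. Let $\{X_\alpha\}_{\alpha\in A}$ be a family of countably compact spaces. A space $X=\bigl(\bigoplus_{\alpha\in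 A}X_\alpha\bigr)\cup\{\infty\}$, obtained as a set by adding one point to the disjoint sum, is a \emph{one-point countably compact modification} of the topological sum of this family if $X$ is countably compact and each $X_\alpha$ (with its own topology) is a clopen subspace of $X$. \textbf{Lemma.} The class of weakly non-commutative Corson countably compact spaces is closed under \begin{enumerate} \item[(1)] countably closed subspaces; \item[(2)] countable products; \item[(3)] continuous images; \item[(4)] finite unions (if finitely many subspaces of a space belong to the class, then so does their union); \item[(5)] finite topological sums; \item[(6)] one-point countably compact modifications of topological sums (of arbitrary families of members of the class). \end{enumerate} -/

import Mathlib

open Set Filter Topology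

universe u v

/-- A set `A` is countably closed if it contains the closure of each of its countable subsets. -/
def IsCountablyClosed {X : Type u} [TopologicalSpace X] (A : Set X) : Prop :=
  ∀ C : Set X, C ⊆ A → C.Countable → closure C ⊆ A

/-- A family `r` of self-maps of `X`, indexed by a partially ordered set `Γ`, is a retractional
skeleton in `X`. The ambient space is meant to be countably compact, Hausdorff and completely
regular. -/
structure IsRetractionalSkeleton {X : Type u} [TopologicalSpace X] {Γ : Type v} [PartialOrder Γ]
    (r : Γ → X → X) : Prop where
  /-- The index set is nonempty and up-directed. -/
  nonempty : Nonempty Γ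
  directed : ∀ s t : Γ, ∃ w : Γ, s ≤ w ∧ t ≤ w
  /-- Each `r s` is a continuous retraction. -/
  continuous : ∀ s, Continuous (r s)
  retraction : ∀ s x, r s (r s x) = r s x
  /-- Each `r s` has a metrizable compact range. -/
  isCompact_range : ∀ s, IsCompact (range (r s))
  metrizable_range : ∀ s, TopologicalSpace.MetrizableSpace (range (r s))
  /-- For `s ≤ t` one has `r s = r t ∘ r s = r s ∘ r t`. -/
  comp_left : ∀ s t, s ≤ t → ∀ x, r t (r s x) = r s x
  comp_right : ∀ s t, s ≤ t → ∀ x, r s (r t x) = r s x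
  /-- Increasing sequences of indices have suprema, along which the retractions converge. -/
  exists_sup : ∀ σ : ℕ → Γ, Monotone σ → ∃ t, IsLUB (range σ) t ∧
    ∀ x, Tendsto (fun n => r (σ n) x) atTop (𝓝 (r t x))
  /-- The retractions converge pointwise to the identity. -/
  tendsto_id : ∀ x, Tendsto (fun s => r s x) atTop (𝓝 x)

/-- The set induced by a family of retractions: the union of their ranges. -/
def inducedSet {X : Type u} {Γ : Type v} (r : Γ → X → X) : Set X :=
  ⋃ s, range (r s)

/-- `X` is a non-commutative Corson countably compact space: a countably compact (Hausdorff,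
completely regular) space with a full retractional skeleton. -/
structure IsNCCorsonCC (X : Type u) [TopologicalSpace X] : Prop where
  t35 : T35Space X
  countablyCompact : CountablyCompactSpace X
  exists_full_skeleton : ∃ (Γ : Type u) (_ : PartialOrder Γ) (r : Γ → X → X),
    IsRetractionalSkeleton r ∧ inducedSet r = univ

/-- `X` is a weakly non-commutative Corson countably compact space: a countably compact
(Hausdorff, completely regular) space that is a continuous image of a non-commutative Corson
countably compact space. -/
structure IsWeaklyNCCorsonCC (X : Type u) [TopologicalSpace X] : Prop where
  t35 : T35Space X
  countablyCompact : CountablyCompactSpace X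
  exists_map : ∃ (Y : Type u) (_ : TopologicalSpace Y) (f : Y → X),
    IsNCCorsonCC Y ∧ Continuous f ∧ Function.Surjective f

/-- `Z` is a one-point countably compact modification of the topological sum of the family `X`:
as a set `Z` is the disjoint union of the `X a` (included through the maps `i a`) and a further
point `p`, the space `Z` is countably compact, and each `X a` (with its own topology) is a clopen
subspace of `Z`. -/
structure IsOnePointCCModification {A : Type v} (X : A → Type u) [∀ a, TopologicalSpace (X a)]
    (Z : Type (max u v)) [TopologicalSpace Z] (i : ∀ a, X a → Z) (p : Z) : Prop where
  countablyCompact_summand : ∀ a, CountablyCompactSpace (X a)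
  bijective : Function.Bijective
    (fun o : Option (Σ a, X a) => o.elim p (fun x => i x.1 x.2))
  countablyCompact : CountablyCompactSpace Z
  isEmbedding : ∀ a, IsEmbedding (i a)
  isClopen_range : ∀ a, IsClopen (range (i a))

/-!
A space with a full retractional skeleton is `ω`-bounded: every countable subset lies in one of the
compact ranges. Two constructions of full skeletons give all the closure properties.

* If `A` is countably closed in a space with a full skeleton `r`, then the indices `s` with
  `r s '' A ⊆ A` are cofinal and closed under suprema of increasing sequences
  (`IsRetractionalSkeleton.exists_le_mapsTo`), so the restrictions of the corresponding retractions
  form a full skeleton of `A`. Hence `IsNCCorsonCC` and, by taking preimages, `IsWeaklyNCCorsonCC`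
  pass to countably closed subspaces.
* Given spaces `Y a` with full skeletons, add an isolated point to each of them, and a least index
  to each skeleton, whose retraction is constant onto the added point. The coordinatewise
  retractions for all families of indices with countable support form a full skeleton of the
  `Σ`-product of the enlarged spaces with respect to the added points
  (`isNCCorsonCC_sigmaProduct`).

If spaces `X a` are images of such `Y a`, then a countable product of them is an image of the
`Σ`-product, which is then the whole product. A one-point countably compact modification of their
sum is an image of the closed subset of those points of the `Σ`-product which have at most one
coordinate different from the added points; the map is continuous at the preimage of the extra point
because each neighbourhood of that point contains all but finitely many summands
(`IsOnePointCCModification.finite_not_subset`). A finite sum is a closed subspace of the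
modification by an isolated point, and a finite union is an image of the finite sum.
-/

/-! ### Countably closed subspaces -/

namespace IsRetractionalSkeleton

variable {X : Type u} [TopologicalSpace X] {Γ : Type v} [PartialOrder Γ] {r : Γ → X → X}

theorem mem_range_iff (h : IsRetractionalSkeleton r) {s : Γ} {x : X} :
    x ∈ range (r s) ↔ r s x = x :=
  ⟨by rintro ⟨y, rfl⟩; exact h.retraction s y, fun hx => ⟨x, hx⟩⟩

theorem range_mono (h : IsRetractionalSkeleton r) {s t : Γ} (hst : s ≤ t) :
    range (r s) ⊆ range (r t) := by
  rintro _ ⟨y, rfl⟩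
  exact ⟨r s y, h.comp_left s t hst y⟩

/-- The ranges of a full skeleton form a family that is directed for countable subsets: this is
where suprema of increasing sequences of indices are needed. -/
theorem exists_countable_subset_range (h : IsRetractionalSkeleton r) (hf : inducedSet r = univ)
    (s : Γ) {C : Set X} (hC : C.Countable) : ∃ t, s ≤ t ∧ C ⊆ range (r t) := by
  rcases C.eq_empty_or_nonempty with rfl | hne
  · exact ⟨s, le_rfl, empty_subset _⟩
  obtain ⟨c, rfl⟩ := hC.exists_eq_range hne
  have hc : ∀ n, ∃ t, c n ∈ range (r t) := fun n => by
    simpa [inducedSet] using (hf ▸ mem_univ (c n) : c n ∈ inducedSet r)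
  choose i hi using hc
  choose w hw₁ hw₂ using h.directed
  let σ : ℕ → Γ := fun n => Nat.rec s (fun n t => w t (i n)) n
  have hσ : Monotone σ := monotone_nat_of_le_succ fun n => hw₁ (σ n) (i n)
  obtain ⟨t, ht, -⟩ := h.exists_sup σ hσ
  refine ⟨t, ht.1 ⟨0, rfl⟩, ?_⟩
  rintro _ ⟨n, rfl⟩
  exact h.range_mono ((hw₂ (σ n) (i n)).trans (ht.1 ⟨n + 1, rfl⟩)) (hi n)

/-- A space with a full skeleton is countably compact, since every sequence lies in a compact
set. -/
theorem countablyCompactSpace (h : IsRetractionalSkeleton r) (hf : inducedSet r = univ) :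
    CountablyCompactSpace X := by
  refine ⟨IsCountablyCompact.of_seq_clusterPt fun x _ => ?_⟩
  obtain ⟨s⟩ := h.nonempty
  obtain ⟨t, -, ht⟩ := h.exists_countable_subset_range hf s (countable_range x)
  obtain ⟨a, -, ha⟩ := (h.isCompact_range t).isCountablyCompact.seq_clusterPt
    x (Eventually.of_forall fun n => ht ⟨n, rfl⟩)
  exact ⟨a, mem_univ a, ha⟩

/-- The image of any set under a retraction of the skeleton is separable, with a countable dense
subset that is the image of a countable set. -/
theorem exists_countable_image_dense (h : IsRetractionalSkeleton r) (s : Γ) (A : Set X) :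
    ∃ C ⊆ A, C.Countable ∧ r s '' A ⊆ closure (r s '' C) := by
  have := h.metrizable_range s
  have := isCompact_iff_compactSpace.1 (h.isCompact_range s)
  have hA : r s '' A ⊆ range (r s) := image_subset_range _ _
  have : SecondCountableTopology (r s '' A) :=
    (IsEmbedding.inclusion hA).secondCountableTopology
  obtain ⟨D, hDc, hD⟩ := TopologicalSpace.exists_countable_dense (r s '' A)
  choose g hgA hg using fun x : (r s '' A) => x.2
  refine ⟨g '' D, ?_, hDc.image g, fun y hy => ?_⟩
  · rintro _ ⟨x, -, rfl⟩
    exact hgA x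
  · have : y ∈ closure (Subtype.val '' D) :=
      image_closure_subset_closure_image continuous_subtype_val ⟨⟨y, hy⟩, hD _, rfl⟩
    rwa [image_image, image_congr fun x _ => hg x]

/-- The indices whose retraction maps a countably closed set `A` into itself are cofinal. Starting
from `s`, one alternately adds a countable subset of `A` whose image under the present retraction
is dense in the image of `A`, and enlarges the index so that its range contains that subset. For
the supremum `t` of the indices, `r t` maps `A` into the closure of the points added. -/
theorem exists_le_mapsTo [T2Space X] (h : IsRetractionalSkeleton r) (hf : inducedSet r = univ)
    {A : Set X} (hA : IsCountablyClosed A) (s : Γ) : ∃ t, s ≤ t ∧ MapsTo (r t) A A := by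
  choose C hCA hCc hCd using fun s => h.exists_countable_image_dense s A
  choose w hw₁ hw₂ using fun s => h.exists_countable_subset_range hf s (hCc s)
  let σ : ℕ → Γ := fun n => Nat.rec s (fun _ t => w t) n
  have hσ : Monotone σ := monotone_nat_of_le_succ fun n => hw₁ (σ n)
  obtain ⟨t, ht, hlim⟩ := h.exists_sup σ hσ
  have hσt : ∀ n, σ n ≤ t := fun n => ht.1 ⟨n, rfl⟩
  refine ⟨t, hσt 0, fun a ha => ?_⟩
  set D : Set X := ⋃ n, C (σ n)
  have hDA : D ⊆ A := iUnion_subset fun n => hCA _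
  suffices r t a ∈ closure D from hA D hDA (countable_iUnion fun n => hCc _) this
  have hDt : closure D ⊆ range (r t) := closure_minimal
    (iUnion_subset fun n => (hw₂ (σ n)).trans (h.range_mono (hσt (n + 1))))
    (h.isCompact_range t).isClosed
  have hDcomp : IsCompact (closure D) := (h.isCompact_range t).of_isClosed_subset isClosed_closure hDt
  have hd : ∀ n, ∃ d ∈ closure D, r (σ n) d = r (σ n) a := fun n => by
    have h₁ : closure (r (σ n) '' C (σ n)) ⊆ r (σ n) '' closure D :=
      closure_minimal (image_mono ((subset_iUnion (fun n => C (σ n)) n).trans subset_closure))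
        (hDcomp.image (h.continuous _)).isClosed
    exact h₁ (hCd _ ⟨a, ha, rfl⟩)
  choose d hdD hda using hd
  obtain ⟨e, heD, he⟩ := hDcomp.isCountablyCompact.seq_clusterPt d (Eventually.of_forall hdD)
  -- the cluster point `e` of the `d n` has the same images as `a` under all `r (σ m)`
  have hea : ∀ m, r (σ m) e = r (σ m) a := fun m => by
    have h₁ : MapClusterPt (r (σ m) e) atTop (r (σ m) ∘ d) :=
      he.continuousAt_comp (h.continuous _).continuousAt
    have h₂ : Tendsto (r (σ m) ∘ d) atTop (𝓝 (r (σ m) a)) := by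
      refine tendsto_const_nhds.congr' ?_
      filter_upwards [eventually_ge_atTop m] with n hn
      rw [Function.comp_apply, ← h.comp_right _ _ (hσ hn) (d n), hda,
        h.comp_right _ _ (hσ hn)]
    exact eq_of_nhds_neBot ((ClusterPt.mono h₁ h₂).neBot)
  have : r t e = r t a :=
    tendsto_nhds_unique (hlim e) ((hlim a).congr fun m => (hea m).symm)
  rwa [← this, h.mem_range_iff.1 (hDt heD)]

/-- Restricting the retractions of a full skeleton to a countably closed set, for those indices
whose retraction preserves the set, gives a full skeleton. -/
theorem restrict [T2Space X] (h : IsRetractionalSkeleton r) (hf : inducedSet r = univ)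
    {A : Set X} (hA : IsCountablyClosed A) :
    let r' : {s : Γ // MapsTo (r s) A A} → A → A := fun s => s.2.restrict (r s.1) A A
    IsRetractionalSkeleton r' ∧ inducedSet r' = univ := by
  intro r'
  have hrange : ∀ s, Subtype.val '' range (r' s) = A ∩ range (r s.1) := fun s => by
    ext x
    constructor
    · rintro ⟨_, ⟨y, rfl⟩, rfl⟩
      exact ⟨s.2 y.2, y, rfl⟩
    · rintro ⟨hx, hx'⟩
      exact ⟨⟨x, hx⟩, ⟨⟨x, hx⟩, Subtype.ext (h.mem_range_iff.1 hx')⟩, rfl⟩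
  refine ⟨?_, ?_⟩
  · constructor
    · obtain ⟨s⟩ := h.nonempty
      obtain ⟨t, -, ht⟩ := h.exists_le_mapsTo hf hA s
      exact ⟨t, ht⟩
    · intro s t
      obtain ⟨w, hs, ht⟩ := h.directed s.1 t.1
      obtain ⟨w', hw, hw'⟩ := h.exists_le_mapsTo hf hA w
      exact ⟨⟨w', hw'⟩, hs.trans hw, ht.trans hw⟩
    · exact fun s => (h.continuous s.1).restrict s.2
    · exact fun s x => Subtype.ext (h.retraction s.1 x)
    · intro s
      rw [Subtype.isCompact_iff, hrange]
      refine (h.isCompact_range s.1).of_isClosed_subset ?_ inter_subset_right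
      -- a closure point of `A ∩ range (r s)` is a limit of a sequence, as the range is metrizable
      have := h.metrizable_range s.1
      have hcl := (h.isCompact_range s.1).isClosed
      have : IsClosed (Subtype.val ⁻¹' A : Set (range (r s.1))) := by
        refine IsSeqClosed.isClosed fun x p hx hp => ?_
        refine hA (range fun n => (x n : X)) ?_ (countable_range _) ?_
        · rintro _ ⟨n, rfl⟩
          exact hx n
        · exact mem_closure_of_tendsto ((continuous_subtype_val.tendsto p).comp hp)
            (Eventually.of_forall fun n => ⟨n, rfl⟩)
      have := (hcl.isClosedEmbedding_subtypeVal.isClosedMap) _ this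
      rwa [Subtype.image_preimage_coe, inter_comm] at this
    · intro s
      have := h.metrizable_range s.1
      have hr : ∀ x : range (r' s), (x : A).1 ∈ range (r s.1) := fun x =>
        ((hrange s).subset ⟨x, x.2, rfl⟩).2
      have he : IsEmbedding fun x : range (r' s) => (⟨x.1.1, hr x⟩ : range (r s.1)) :=
        (IsEmbedding.subtypeVal.comp IsEmbedding.subtypeVal).codRestrict _ hr
      exact he.metrizableSpace
    · exact fun s t hst x => Subtype.ext (h.comp_left s.1 t.1 hst x)
    · exact fun s t hst x => Subtype.ext (h.comp_right s.1 t.1 hst x)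
    · intro σ hσ
      obtain ⟨t, ht, hlim⟩ := h.exists_sup (fun n => (σ n).1) fun m n hmn => hσ hmn
      have htA : MapsTo (r t) A A := fun a ha => by
        refine hA (range fun n => r (σ n).1 a) ?_ (countable_range _) ?_
        · rintro _ ⟨n, rfl⟩
          exact (σ n).2 ha
        · exact mem_closure_of_tendsto (hlim a) (Eventually.of_forall fun n => ⟨n, rfl⟩)
      refine ⟨⟨t, htA⟩, ⟨?_, fun w hw => ?_⟩, fun x => tendsto_subtype_rng.2 (hlim x)⟩
      · rintro _ ⟨n, rfl⟩
        exact ht.1 ⟨n, rfl⟩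
      · refine ht.2 ?_
        rintro _ ⟨n, rfl⟩
        exact hw ⟨n, rfl⟩
    · intro x
      refine tendsto_subtype_rng.2 ((h.tendsto_id x).comp ?_)
      refine Monotone.tendsto_atTop_atTop (fun s t hst => hst) fun s => ?_
      obtain ⟨t, hst, ht⟩ := h.exists_le_mapsTo hf hA s
      exact ⟨⟨t, ht⟩, hst⟩
  · refine eq_univ_of_forall fun x => ?_
    obtain ⟨s⟩ := h.nonempty
    obtain ⟨t, -, ht⟩ := h.exists_countable_subset_range hf s (countable_singleton x.1)
    obtain ⟨w, htw, hw⟩ := h.exists_le_mapsTo hf hA t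
    exact mem_iUnion.2 ⟨⟨w, hw⟩, x,
      Subtype.ext (h.mem_range_iff.1 (h.range_mono htw (ht rfl)))⟩

end IsRetractionalSkeleton

/-! ### The two classes of spaces -/

/-- Countable compactness need not be assumed in `IsNCCorsonCC`. -/
theorem IsNCCorsonCC.of_skeleton {X : Type u} [TopologicalSpace X] [T35Space X] {Γ : Type u}
    [PartialOrder Γ] {r : Γ → X → X} (h : IsRetractionalSkeleton r) (hf : inducedSet r = univ) :
    IsNCCorsonCC X :=
  ⟨inferInstance, h.countablyCompactSpace hf, Γ, inferInstance, r, h, hf⟩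

theorem IsNCCorsonCC.subtype {X : Type u} [TopologicalSpace X] (hX : IsNCCorsonCC X) {A : Set X}
    (hA : IsCountablyClosed A) : IsNCCorsonCC A := by
  have := hX.t35
  obtain ⟨Γ, _, r, h, hf⟩ := hX.exists_full_skeleton
  exact .of_skeleton (h.restrict hf hA).1 (h.restrict hf hA).2

theorem IsClosed.isCountablyClosed {X : Type u} [TopologicalSpace X] {A : Set X}
    (hA : IsClosed A) : IsCountablyClosed A :=
  fun _ hC _ => closure_minimal hC hA

theorem IsCountablyClosed.preimage {X : Type u} {Y : Type v} [TopologicalSpace X]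
    [TopologicalSpace Y] {A : Set X} (hA : IsCountablyClosed A) {f : Y → X} (hf : Continuous f) :
    IsCountablyClosed (f ⁻¹' A) := fun _ hC hCc =>
  (closure_subset_preimage_closure_image hf).trans <|
    preimage_mono (hA _ (image_subset_iff.2 hC) (hCc.image f))

theorem IsWeaklyNCCorsonCC.of_surjective {Y Z : Type u} [TopologicalSpace Y] [TopologicalSpace Z]
    [T35Space Z] (hY : IsNCCorsonCC Y) {f : Y → Z} (hf : Continuous f)
    (hs : Function.Surjective f) : IsWeaklyNCCorsonCC Z := by
  have := hY.countablyCompact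
  refine ⟨inferInstance, ⟨?_⟩, Y, inferInstance, f, hY, hf, hs⟩
  rw [← hs.range_eq, ← image_univ]
  exact CountablyCompactSpace.isCountablyCompact_univ.image hf

theorem IsWeaklyNCCorsonCC.image {X Z : Type u} [TopologicalSpace X] [TopologicalSpace Z]
    [T35Space Z] (hX : IsWeaklyNCCorsonCC X) {f : X → Z} (hf : Continuous f)
    (hs : Function.Surjective f) : IsWeaklyNCCorsonCC Z := by
  obtain ⟨Y, _, g, hY, hg, hgs⟩ := hX.exists_map
  exact .of_surjective hY (hf.comp hg) (hs.comp hgs)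

theorem IsWeaklyNCCorsonCC.subtype {X : Type u} [TopologicalSpace X] (hX : IsWeaklyNCCorsonCC X)
    {S : Set X} (hS : IsCountablyClosed S) : IsWeaklyNCCorsonCC S := by
  have := hX.t35
  obtain ⟨Y, _, g, hY, hg, hgs⟩ := hX.exists_map
  exact .of_surjective (hY.subtype (hS.preimage hg)) (hg.restrictPreimage (s := S))
    (hgs.restrictPreimage S)

/-! ### Complete regularity of products and sums -/

theorem t35Space_of_uniformSpace (X : Type u) [UniformSpace X] [T0Space X] : T35Space X where

instance T35Space.pi {ι : Type v} {X : ι → Type u} [∀ i, TopologicalSpace (X i)]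
    [∀ i, T35Space (X i)] : T35Space (∀ i, X i) := by
  choose U hU using fun i => CompletelyRegularSpace.exists_uniformSpace (X := X i)
  obtain rfl : (fun i => (U i).toTopologicalSpace) = ‹∀ i, TopologicalSpace (X i)› :=
    funext fun i => (hU i)
  exact t35Space_of_uniformSpace _

instance T35Space.sum {X : Type u} {Y : Type v} [TopologicalSpace X] [TopologicalSpace Y]
    [T35Space X] [T35Space Y] : T35Space (X ⊕ Y) := by
  obtain ⟨U, rfl⟩ := CompletelyRegularSpace.exists_uniformSpace (X := X)
  obtain ⟨V, rfl⟩ := CompletelyRegularSpace.exists_uniformSpace (X := Y)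
  exact t35Space_of_uniformSpace _

instance T35Space.sigma {ι : Type v} {X : ι → Type u} [∀ i, TopologicalSpace (X i)]
    [∀ i, T35Space (X i)] : T35Space (Σ i, X i) where
  completely_regular x K hK hx := by
    classical
    obtain ⟨i, x⟩ := x
    obtain ⟨f, hf, hfx, hfK⟩ := CompletelyRegularSpace.completely_regular x (Sigma.mk i ⁻¹' K)
      (hK.preimage continuous_sigmaMk) hx
    let g : ∀ j, X j → unitInterval := Function.update (fun _ _ => 1) i f
    have hgi : g i = f := Function.update_self ..
    have hgj : ∀ j ≠ i, g j = fun _ => 1 := fun j hj => Function.update_of_ne hj ..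
    refine ⟨fun z => g z.1 z.2, continuous_sigma fun j => ?_, ?_, ?_⟩
    · by_cases hj : j = i
      · subst hj
        simpa only [hgi] using hf
      · simpa only [hgj j hj] using continuous_const
    · simpa only [hgi] using hfx
    · rintro ⟨j, y⟩ hy
      by_cases hj : j = i
      · subst hj
        simpa only [hgi, Pi.one_apply] using hfK hy
      · simp only [hgj j hj, Pi.one_apply]

/-! ### `Σ`-products -/

/-- The `Σ`-product of the spaces `T a` with base points `p a`: the points of the product that
differ from the base point in at most countably many coordinates. -/
def sigmaProduct {A : Type v} {T : A → Type u} (p : ∀ a, T a) : Set (∀ a, T a) :=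
  {x | {a | x a ≠ p a}.Countable}

/-- The indices for the skeleton of a `Σ`-product: families of indices, all but countably many of
which are the least one. -/
abbrev CountableSupportIndex {A : Type v} (Γ : A → Type u) [∀ a, PartialOrder (Γ a)]
    [∀ a, OrderBot (Γ a)] :=
  {s : ∀ a, Γ a // {a | s a ≠ ⊥}.Countable}

section SigmaProduct

variable {A : Type v} {T : A → Type u} [∀ a, TopologicalSpace (T a)] {Γ : A → Type u}
  [∀ a, PartialOrder (Γ a)] [∀ a, OrderBot (Γ a)] {p : ∀ a, T a} {r : ∀ a, Γ a → T a → T a}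

/-- The retraction of a `Σ`-product acting by `r a (s a)` on the coordinate `a`; here `r a ⊥` is
meant to be the constant map onto the base point. -/
def sigmaProductRetraction (hr : ∀ a x, r a ⊥ x = p a) (s : CountableSupportIndex Γ)
    (x : sigmaProduct p) : sigmaProduct p :=
  ⟨fun a => r a (s.1 a) (x.1 a),
    s.2.mono fun a (ha : r a (s.1 a) (x.1 a) ≠ p a) (hs : s.1 a = ⊥) => ha (by rw [hs, hr])⟩

variable (hr : ∀ a x, r a ⊥ x = p a)

theorem mem_range_sigmaProductRetraction (h : ∀ a, IsRetractionalSkeleton (r a))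
    {s : CountableSupportIndex Γ} {x : sigmaProduct p} :
    x ∈ range (sigmaProductRetraction hr s) ↔ ∀ a, x.1 a ∈ range (r a (s.1 a)) := by
  constructor
  · rintro ⟨y, rfl⟩ a
    exact ⟨y.1 a, rfl⟩
  · exact fun hx => ⟨x, Subtype.ext (funext fun a => (h a).mem_range_iff.1 (hx a))⟩

theorem isCompact_range_sigmaProductRetraction (h : ∀ a, IsRetractionalSkeleton (r a))
    (s : CountableSupportIndex Γ) : IsCompact (range (sigmaProductRetraction hr s)) := by
  rw [Subtype.isCompact_iff]
  convert isCompact_univ_pi fun a => (h a).isCompact_range (s.1 a) using 1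
  ext x
  simp only [mem_image, mem_range_sigmaProductRetraction hr h, mem_univ_pi]
  constructor
  · rintro ⟨y, hy, rfl⟩
    exact hy
  · refine fun hx => ⟨⟨x, s.2.mono fun a (ha : x a ≠ p a) (hs : s.1 a = ⊥) => ha ?_⟩, hx, rfl⟩
    obtain ⟨y, hy⟩ := hx a
    rw [← hy, hs, hr]

/-- The range of the retraction with index `s` embeds into a product over the countable set of
those `a` with `s a ≠ ⊥`. -/
theorem metrizable_range_sigmaProductRetraction [∀ a, T2Space (T a)]
    (h : ∀ a, IsRetractionalSkeleton (r a)) (s : CountableSupportIndex Γ) :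
    TopologicalSpace.MetrizableSpace (range (sigmaProductRetraction hr s)) := by
  have := isCompact_iff_compactSpace.1 (isCompact_range_sigmaProductRetraction hr h s)
  have := fun a => (h a).metrizable_range (s.1 a)
  have := fun a => isCompact_iff_compactSpace.1 ((h a).isCompact_range (s.1 a))
  have : Countable {a // s.1 a ≠ ⊥} := s.2.to_subtype
  have hmem (x : range (sigmaProductRetraction hr s)) (a : A) :
      x.1.1 a ∈ range (r a (s.1 a)) := (mem_range_sigmaProductRetraction hr h).1 x.2 a
  let φ : range (sigmaProductRetraction hr s) → ∀ a : {a // s.1 a ≠ ⊥}, range (r a (s.1 a)) :=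
    fun x a => ⟨x.1.1 a, hmem x a⟩
  have hφ : Continuous φ := continuous_pi fun a => Continuous.subtype_mk
    ((continuous_apply _).comp (continuous_subtype_val.comp continuous_subtype_val)) _
  refine (hφ.isClosedEmbedding fun x y hxy => ?_).isEmbedding.metrizableSpace
  refine Subtype.ext (Subtype.ext (funext fun a => ?_))
  by_cases ha : s.1 a = ⊥
  · obtain ⟨y₁, h₁⟩ := hmem x a
    obtain ⟨y₂, h₂⟩ := hmem y a
    rw [← h₁, ← h₂, ha, hr, hr]
  · exact congrArg Subtype.val (congrFun hxy ⟨a, ha⟩)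

open Classical in
/-- The index with the single nontrivial coordinate `g` at `a`. -/
noncomputable def CountableSupportIndex.single (a : A) (g : Γ a) : CountableSupportIndex Γ :=
  ⟨Function.update ⊥ a g, (countable_singleton a).mono fun b hb => by
    by_contra hne
    exact hb (Function.update_of_ne hne _ _)⟩

theorem isRetractionalSkeleton_sigmaProductRetraction [∀ a, T2Space (T a)]
    (h : ∀ a, IsRetractionalSkeleton (r a)) :
    IsRetractionalSkeleton (sigmaProductRetraction hr) where
  nonempty := ⟨⊥, by simp⟩
  directed s t := by
    classical
    choose w hw₁ hw₂ using fun a => (h a).directed (s.1 a) (t.1 a)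
    refine ⟨⟨fun a => if s.1 a = ⊥ ∧ t.1 a = ⊥ then ⊥ else w a,
      (s.2.union t.2).mono fun a ha => ?_⟩, fun a => ?_, fun a => ?_⟩
    · by_contra hc
      simp only [mem_union, mem_ofPred_eq, not_or, not_not] at hc
      exact ha (if_pos hc)
    · dsimp only
      split_ifs with hc
      · exact hc.1.le
      · exact hw₁ a
    · dsimp only
      split_ifs with hc
      · exact hc.2.le
      · exact hw₂ a
  continuous s := Continuous.subtype_mk (continuous_pi fun a =>
    ((h a).continuous _).comp ((continuous_apply a).comp continuous_subtype_val)) _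
  retraction s x := Subtype.ext (funext fun a => (h a).retraction _ _)
  isCompact_range := isCompact_range_sigmaProductRetraction hr h
  metrizable_range := metrizable_range_sigmaProductRetraction hr h
  comp_left s t hst x := Subtype.ext (funext fun a => (h a).comp_left _ _ (hst a) _)
  comp_right s t hst x := Subtype.ext (funext fun a => (h a).comp_right _ _ (hst a) _)
  exists_sup σ hσ := by
    choose t ht hlim using fun a => (h a).exists_sup (fun n => (σ n).1 a) fun m n hmn => hσ hmn a
    have htc : {a | t a ≠ ⊥}.Countable := by
      refine (countable_iUnion fun n => (σ n).2).mono fun a ha => ?_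
      by_contra hc
      simp only [mem_iUnion, mem_ofPred_eq, not_exists, not_not] at hc
      refine ha (le_bot_iff.1 ((ht a).2 ?_))
      rintro _ ⟨n, rfl⟩
      exact (hc n).le
    refine ⟨⟨t, htc⟩, ⟨?_, fun w hw a => (ht a).2 ?_⟩, fun x => ?_⟩
    · rintro _ ⟨n, rfl⟩ a
      exact (ht a).1 ⟨n, rfl⟩
    · rintro _ ⟨n, rfl⟩
      exact hw ⟨n, rfl⟩ a
    · exact tendsto_subtype_rng.2 (tendsto_pi_nhds.2 fun a => hlim a (x.1 a))
  tendsto_id x := by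
    refine tendsto_subtype_rng.2 (tendsto_pi_nhds.2 fun a => ((h a).tendsto_id (x.1 a)).comp ?_)
    refine Monotone.tendsto_atTop_atTop (f := fun s : CountableSupportIndex Γ => s.1 a)
      (fun s t hst => hst a) fun g => ⟨.single a g, ?_⟩
    simp [CountableSupportIndex.single]

theorem inducedSet_sigmaProductRetraction (h : ∀ a, IsRetractionalSkeleton (r a))
    (hf : ∀ a, inducedSet (r a) = univ) : inducedSet (sigmaProductRetraction hr) = univ := by
  classical
  refine eq_univ_of_forall fun x => ?_
  have hx : ∀ a, ∃ s, x.1 a ∈ range (r a s) := fun a => by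
    simpa [inducedSet] using (hf a ▸ mem_univ (x.1 a) : x.1 a ∈ inducedSet (r a))
  choose s hs using hx
  refine mem_iUnion.2 ⟨⟨fun a => if x.1 a = p a then ⊥ else s a, x.2.mono fun a ha => ?_⟩, ?_⟩
  · exact fun hc => ha (if_pos hc)
  · refine (mem_range_sigmaProductRetraction hr h).2 fun a => ?_
    dsimp only
    split_ifs with hc
    · exact ⟨x.1 a, by rw [hr, hc]⟩
    · exact hs a

end SigmaProduct

/-! ### Adding an isolated point -/

section AddPoint

variable {Y Γ : Type u} {r : Γ → Y → Y}

/-- The retractions of `Y` with an isolated point added, which is fixed by all of them. The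
additional least index gives the constant map onto the added point. -/
def addPointRetraction (r : Γ → Y → Y) (s : WithBot Γ) : Y ⊕ PUnit.{u + 1} → Y ⊕ PUnit.{u + 1} :=
  s.recBotCoe (fun _ => Sum.inr PUnit.unit) fun s => Sum.map (r s) id

@[simp]
theorem addPointRetraction_bot (x : Y ⊕ PUnit.{u + 1}) :
    addPointRetraction r ⊥ x = Sum.inr PUnit.unit := rfl

@[simp]
theorem addPointRetraction_coe_inl (s : Γ) (y : Y) :
    addPointRetraction r s (Sum.inl y) = Sum.inl (r s y) := rfl

@[simp]
theorem addPointRetraction_inr (s : WithBot Γ) (u : PUnit.{u + 1}) :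
    addPointRetraction r s (Sum.inr u) = Sum.inr u := by
  cases s <;> rfl

theorem inducedSet_addPointRetraction
    (hf : inducedSet r = univ) : inducedSet (addPointRetraction r) = univ := by
  refine eq_univ_of_forall fun x => mem_iUnion.2 ?_
  rcases x with x | x
  · obtain ⟨s, y, rfl⟩ := mem_iUnion.1 (hf ▸ mem_univ x : x ∈ inducedSet r)
    exact ⟨s, Sum.inl y, rfl⟩
  · exact ⟨⊥, Sum.inr x, by simp⟩

variable [TopologicalSpace Y]

theorem continuous_addPointRetraction (hr : ∀ s, Continuous (r s)) (s : WithBot Γ) :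
    Continuous (addPointRetraction r s) := by
  cases s with
  | bot => exact continuous_const
  | coe s => exact (hr s).sumMap continuous_id

variable [PartialOrder Γ]

/-- The range of `addPointRetraction r s` is a point or homeomorphic to the range of `r s` with an
isolated point added. -/
theorem isCompact_metrizable_range_addPointRetraction [T2Space Y] (h : IsRetractionalSkeleton r)
    (s : WithBot Γ) : IsCompact (range (addPointRetraction r s)) ∧
      TopologicalSpace.MetrizableSpace (range (addPointRetraction r s)) := by
  cases s with
  | bot =>
    have : range (addPointRetraction r ⊥) = {Sum.inr PUnit.unit} := range_const
    rw [this]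
    exact ⟨isCompact_singleton, inferInstance⟩
  | coe s =>
    have := isCompact_iff_compactSpace.1 (h.isCompact_range s)
    have := h.metrizable_range s
    let e : range (r s) ⊕ PUnit.{u + 1} → Y ⊕ PUnit.{u + 1} := Sum.map Subtype.val id
    have he : IsClosedEmbedding e := (continuous_subtype_val.sumMap continuous_id).isClosedEmbedding
      (Subtype.val_injective.sumMap Function.injective_id)
    have hrange : range (addPointRetraction r s) = range e := by
      ext x
      rcases x with x | x
      · simp [e, addPointRetraction, Sum.map]
      · simp [e, addPointRetraction, Sum.map]
    rw [hrange]
    exact ⟨isCompact_range he.continuous, he.isEmbedding.toHomeomorph.symm.isEmbedding.metrizableSpace⟩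

theorem isRetractionalSkeleton_addPointRetraction [T2Space Y] (h : IsRetractionalSkeleton r) :
    IsRetractionalSkeleton (addPointRetraction r) where
  nonempty := inferInstance
  directed s t := by
    cases s with
    | bot => exact ⟨t, bot_le, le_rfl⟩
    | coe s =>
      cases t with
      | bot => exact ⟨s, le_rfl, bot_le⟩
      | coe t =>
        obtain ⟨w, hs, ht⟩ := h.directed s t
        exact ⟨w, WithBot.coe_le_coe.2 hs, WithBot.coe_le_coe.2 ht⟩
  continuous := continuous_addPointRetraction h.continuous
  retraction s x := by
    cases s <;> cases x <;> simp [h.retraction]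
  isCompact_range s := (isCompact_metrizable_range_addPointRetraction h s).1
  metrizable_range s := (isCompact_metrizable_range_addPointRetraction h s).2
  comp_left s t hst x := by
    cases s with
    | bot => simp
    | coe s =>
      lift t to Γ using (lt_of_lt_of_le (WithBot.bot_lt_coe s) hst).ne'
      cases x <;> simp [h.comp_left s t (WithBot.coe_le_coe.1 hst)]
  comp_right s t hst x := by
    cases s with
    | bot => simp
    | coe s =>
      lift t to Γ using (lt_of_lt_of_le (WithBot.bot_lt_coe s) hst).ne'
      cases x <;> simp [h.comp_right s t (WithBot.coe_le_coe.1 hst)]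
  exists_sup σ hσ := by
    by_cases hbot : ∀ n, σ n = ⊥
    · refine ⟨⊥, ?_, fun x => by simp [hbot]⟩
      simp [funext hbot]
    · -- from some `N` on, the indices lie in `Γ`
      push Not at hbot
      obtain ⟨N, hN⟩ := hbot
      have hne : ∀ n, σ (n + N) ≠ ⊥ := fun n =>
        ((bot_lt_iff_ne_bot.2 hN).trans_le (hσ (Nat.le_add_left N n))).ne'
      choose τ hτ using fun n => WithBot.ne_bot_iff_exists.1 (hne n)
      obtain ⟨t, ht, hlim⟩ := h.exists_sup τ fun m n hmn => by
        rw [← WithBot.coe_le_coe, hτ, hτ]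
        exact hσ (by omega)
      refine ⟨t, ⟨?_, fun w hw => ?_⟩, fun x => ?_⟩
      · rintro _ ⟨n, rfl⟩
        refine (hσ (Nat.le_add_right n N)).trans ?_
        rw [← hτ]
        exact WithBot.coe_le_coe.2 (ht.1 ⟨n, rfl⟩)
      · lift w to Γ using ((bot_lt_iff_ne_bot.2 hN).trans_le (hw ⟨N, rfl⟩)).ne'
        refine WithBot.coe_le_coe.2 (ht.2 ?_)
        rintro _ ⟨n, rfl⟩
        rw [← WithBot.coe_le_coe, hτ]
        exact hw ⟨_, rfl⟩
      · rcases x with x | x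
        · refine (tendsto_add_atTop_iff_nat N).1 ?_
          simp only [← hτ, addPointRetraction_coe_inl]
          exact (continuous_inl.tendsto _).comp (hlim x)
        · simp
  tendsto_id x := by
    rcases x with x | x
    · intro U hU
      obtain ⟨s₀⟩ := h.nonempty
      have : Nonempty Γ := ⟨s₀⟩
      have : IsDirectedOrder Γ := ⟨h.directed⟩
      obtain ⟨s, hs⟩ := mem_atTop_sets.1
        (h.tendsto_id x (continuous_inl.continuousAt.preimage_mem_nhds hU))
      refine mem_map.2 (mem_of_superset (mem_atTop (s : WithBot Γ)) fun t hst => ?_)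
      lift t to Γ using (lt_of_lt_of_le (WithBot.bot_lt_coe s) hst).ne'
      exact hs t (WithBot.coe_le_coe.1 hst)
    · simpa using tendsto_const_nhds

end AddPoint

/-- The `Σ`-product of the spaces `Y a`, each with an isolated base point added. -/
theorem isNCCorsonCC_sigmaProduct {A : Type v} {Y : A → Type u} [∀ a, TopologicalSpace (Y a)]
    (hY : ∀ a, IsNCCorsonCC (Y a)) :
    IsNCCorsonCC (sigmaProduct fun a => (Sum.inr PUnit.unit : Y a ⊕ PUnit.{u + 1})) := by
  have := fun a => (hY a).t35
  choose Γ _ r h hf using fun a => (hY a).exists_full_skeleton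
  have h' := fun a => isRetractionalSkeleton_addPointRetraction (h a)
  have hr : ∀ a x, addPointRetraction (r a) ⊥ x = Sum.inr PUnit.unit := fun a x => rfl
  exact .of_skeleton (isRetractionalSkeleton_sigmaProductRetraction hr h')
    (inducedSet_sigmaProductRetraction hr h' fun a => inducedSet_addPointRetraction (hf a))

/-! ### One-point modifications -/

namespace IsOnePointCCModification

variable {A : Type v} {X : A → Type u} [∀ a, TopologicalSpace (X a)] {Z : Type (max u v)}
  [TopologicalSpace Z] {i : ∀ a, X a → Z} {p : Z}

theorem eq_of_mem_range (h : IsOnePointCCModification X Z i p) {a b : A} {z : Z}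
    (ha : z ∈ range (i a)) (hb : z ∈ range (i b)) : a = b := by
  obtain ⟨x, rfl⟩ := ha
  obtain ⟨y, hy⟩ := hb
  have := @h.bijective.1 (some ⟨b, y⟩) (some ⟨a, x⟩) hy
  simp only [Option.some.injEq, Sigma.mk.injEq] at this
  exact this.1.symm

theorem eq_or_mem_range (h : IsOnePointCCModification X Z i p) (z : Z) :
    z = p ∨ ∃ a, z ∈ range (i a) := by
  obtain ⟨o, rfl⟩ := h.bijective.2 z
  rcases o with _ | ⟨a, x⟩
  · exact Or.inl rfl
  · exact Or.inr ⟨a, x, rfl⟩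

/-- A neighbourhood of the added point contains all but finitely many summands: otherwise a sequence
of points outside it, taken from different summands, would have no cluster point. -/
theorem finite_not_subset (h : IsOnePointCCModification X Z i p) {U : Set Z} (hU : U ∈ 𝓝 p) :
    {a | ¬ range (i a) ⊆ U}.Finite := by
  by_contra hinf
  let a := Set.Infinite.natEmbedding _ hinf
  choose z hz hzU using fun n => not_subset.1 (a n).2
  have := h.countablyCompact
  obtain ⟨w, -, hw⟩ := CountablyCompactSpace.isCountablyCompact_univ.seq_clusterPt z (by simp)
  rcases h.eq_or_mem_range w with rfl | ⟨b, hb⟩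
  · obtain ⟨n, hn⟩ := (hw.frequently hU).exists
    exact hzU n hn
  · have hfr := hw.frequently ((h.isClopen_range b).isOpen.mem_nhds hb)
    obtain ⟨n, hn⟩ := hfr.exists
    obtain ⟨m, hnm, hm⟩ := (frequently_atTop.1 hfr) (n + 1)
    have : a n = a m := Subtype.ext
      ((h.eq_of_mem_range (hz n) hn).trans (h.eq_of_mem_range (hz m) hm).symm)
    have := a.injective this
    omega

end IsOnePointCCModification

/-- The points of the product of the spaces `Y a`, each with an isolated point added, that have at
most one coordinate in the original spaces. -/
def atMostOneInl {A : Type v} (Y : A → Type u) : Set (∀ a, Y a ⊕ PUnit.{u + 1}) :=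
  {x | ∀ a b, x a ∈ range Sum.inl → x b ∈ range Sum.inl → a = b}

theorem isClosed_atMostOneInl {A : Type v} (Y : A → Type u) [∀ a, TopologicalSpace (Y a)] :
    IsClosed (atMostOneInl Y) := by
  have h : ∀ a, IsClopen {x : ∀ a, Y a ⊕ PUnit.{u + 1} | x a ∈ range Sum.inl} := fun a =>
    isClopen_range_inl.preimage (continuous_apply a)
  have : atMostOneInl Y = ⋂ (a) (b), {x | x a ∈ range Sum.inl → x b ∈ range Sum.inl → a = b} := by
    ext x
    simp only [atMostOneInl, mem_iInter, mem_ofPred_eq]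
  rw [this]
  exact isClosed_iInter fun a => isClosed_iInter fun b =>
    isClosed_imp (h a).isOpen <| isClosed_imp (h b).isOpen isClosed_const

/-- The one-point modification is a continuous image of `atMostOneInl Y`. The nontrivial coordinate
of a point, if there is one, is mapped into the corresponding summand, and the point without
nontrivial coordinate is mapped to the added point. -/
theorem IsOnePointCCModification.isWeaklyNCCorsonCC {A : Type v} {X : A → Type u}
    [∀ a, TopologicalSpace (X a)] {Z : Type (max u v)} [TopologicalSpace Z] [T35Space Z]
    {i : ∀ a, X a → Z} {p : Z} (h : IsOnePointCCModification X Z i p)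
    (hX : ∀ a, IsWeaklyNCCorsonCC (X a)) : IsWeaklyNCCorsonCC Z := by
  classical
  choose Y _ f hY hf hfs using fun a => (hX a).exists_map
  let S := sigmaProduct fun a => (Sum.inr PUnit.unit : Y a ⊕ PUnit.{u + 1})
  let D : Set S := Subtype.val ⁻¹' atMostOneInl Y
  have hD : IsNCCorsonCC D := (isNCCorsonCC_sigmaProduct hY).subtype
    ((isClosed_atMostOneInl Y).preimage continuous_subtype_val).isCountablyClosed
  let ψ : ∀ a, Y a ⊕ PUnit.{u + 1} → Z := fun a => Sum.elim (i a ∘ f a) fun _ => p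
  have hψ : ∀ a, Continuous (ψ a) := fun a =>
    ((h.isEmbedding a).continuous.comp (hf a)).sumElim continuous_const
  have hg : ∀ x : D, ∃ z, (∀ a, x.1.1 a ∈ range Sum.inl → z = ψ a (x.1.1 a)) ∧
      ((∀ a, x.1.1 a ∉ range Sum.inl) → z = p) := fun x => by
    by_cases hx : ∃ a, x.1.1 a ∈ range Sum.inl
    · obtain ⟨a, ha⟩ := hx
      refine ⟨ψ a (x.1.1 a), fun b hb => ?_, fun hn => (hn a ha).elim⟩
      obtain rfl := x.2 a b ha hb
      rfl
    · push Not at hx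
      exact ⟨p, fun a ha => (hx a ha).elim, fun _ => rfl⟩
  choose g hg₁ hg₂ using hg
  have happ : ∀ a, Continuous fun x : D => x.1.1 a := fun a =>
    (continuous_apply a).comp (continuous_subtype_val.comp continuous_subtype_val)
  have hopen : ∀ a, IsClopen {x : D | x.1.1 a ∈ range Sum.inl} := fun a =>
    isClopen_range_inl.preimage (happ a)
  refine .of_surjective hD (f := g) (continuous_iff_continuousAt.2 fun x => ?_) fun z => ?_
  · by_cases hx : ∃ a, x.1.1 a ∈ range Sum.inl
    · obtain ⟨a, ha⟩ := hx
      refine ((hψ a).comp (happ a)).continuousAt.congr ?_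
      filter_upwards [(hopen a).isOpen.mem_nhds ha] with y hy
      exact (hg₁ y a hy).symm
    · push Not at hx
      intro U hU
      rw [hg₂ x hx] at hU
      have hfin := h.finite_not_subset hU
      have hev : ∀ᶠ y in 𝓝 x, ∀ a ∈ {a | ¬ range (i a) ⊆ U}, y.1.1 a ∉ range Sum.inl :=
        (eventually_all_finite hfin).2 fun a _ => (hopen a).compl.isOpen.mem_nhds (hx a)
      refine mem_map.2 ?_
      filter_upwards [hev] with y hy
      by_cases hy' : ∃ a, y.1.1 a ∈ range Sum.inl
      · obtain ⟨a, ha⟩ := hy'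
        have haU : range (i a) ⊆ U := by
          by_contra hc
          exact hy a hc ha
        rw [mem_preimage, hg₁ y a ha]
        obtain ⟨w, hw⟩ := ha
        rw [← hw]
        exact haU ⟨f a w, rfl⟩
      · push Not at hy'
        rw [mem_preimage, hg₂ y hy']
        exact mem_of_mem_nhds hU
  · rcases h.eq_or_mem_range z with rfl | ⟨a, x, rfl⟩
    · refine ⟨⟨⟨fun _ => Sum.inr PUnit.unit, by simp [S, sigmaProduct]⟩, ?_⟩, hg₂ _ ?_⟩
      · rintro a b ⟨w, hw⟩
        exact (Sum.inl_ne_inr hw).elim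
      · rintro a ⟨w, hw⟩
        exact Sum.inl_ne_inr hw
    · obtain ⟨y, rfl⟩ := hfs a x
      let e : ∀ a, Y a ⊕ PUnit.{u + 1} :=
        Function.update (fun _ => Sum.inr PUnit.unit) a (Sum.inl y)
      have hea : e a = Sum.inl y := Function.update_self ..
      have heb : ∀ b ≠ a, e b = Sum.inr PUnit.unit := fun b hb => Function.update_of_ne hb ..
      have heb' : ∀ b, e b ∈ range Sum.inl → b = a := by
        rintro b ⟨w, hw⟩
        by_contra hb
        exact Sum.inl_ne_inr (hw.trans (heb b hb))
      have heS : e ∈ S := (countable_singleton a).mono fun b hb => by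
        by_contra hc
        exact hb (heb b hc)
      refine ⟨⟨⟨e, heS⟩, fun b c hb hc => (heb' b hb).trans (heb' c hc).symm⟩, ?_⟩
      rw [hg₁ _ a ⟨y, hea.symm⟩]
      simp [ψ, hea]

/-! ### Products, sums and unions -/

theorem IsWeaklyNCCorsonCC.pi {ι : Type v} [Countable ι] {X : ι → Type u}
    [∀ i, TopologicalSpace (X i)] (hX : ∀ i, IsWeaklyNCCorsonCC (X i)) :
    IsWeaklyNCCorsonCC (∀ i, X i) := by
  have := fun i => (hX i).t35
  choose Y _ f hY hf hfs using fun i => (hX i).exists_map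
  let S := sigmaProduct fun i => (Sum.inr PUnit.unit : Y i ⊕ PUnit.{u + 1})
  have hS : IsNCCorsonCC S := isNCCorsonCC_sigmaProduct hY
  by_cases hne : Nonempty (∀ i, X i)
  · obtain ⟨p⟩ := hne
    -- the added points are mapped to the coordinates of the arbitrary point `p`
    let ψ : ∀ i, Y i ⊕ PUnit.{u + 1} → X i := fun i => Sum.elim (f i) fun _ => p i
    refine .of_surjective hS (f := fun x i => ψ i (x.1 i)) (continuous_pi fun i =>
      ((hf i).sumElim continuous_const).comp ((continuous_apply i).comp continuous_subtype_val))
      fun x => ?_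
    choose y hy using fun i => hfs i (x i)
    exact ⟨⟨fun i => Sum.inl (y i), to_countable _⟩, funext hy⟩
  · have : IsEmpty (∀ i, X i) := not_nonempty_iff.1 hne
    exact .of_surjective (hS.subtype isClosed_empty.isCountablyClosed)
      (f := fun x => x.2.elim) (continuous_iff_continuousAt.2 fun x => x.2.elim) fun x => isEmptyElim x

/-- The topological sum of a finite family, with an isolated point added, is a one-point
modification. -/
theorem isOnePointCCModification_sigma {ι : Type v} [Finite ι] {X : ι → Type u}
    [∀ i, TopologicalSpace (X i)] (hX : ∀ i, CountablyCompactSpace (X i)) :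
    IsOnePointCCModification X ((Σ i, X i) ⊕ PUnit.{max u v + 1})
      (fun i x => Sum.inl ⟨i, x⟩) (Sum.inr PUnit.unit) where
  countablyCompact_summand := hX
  bijective := by
    refine ⟨?_, ?_⟩
    · rintro (_ | x) (_ | y) hxy
      · rfl
      · exact (Sum.inr_ne_inl hxy).elim
      · exact (Sum.inl_ne_inr hxy).elim
      · exact congrArg some (Sum.inl_injective hxy)
    · rintro (x | x)
      · exact ⟨some x, rfl⟩
      · exact ⟨none, rfl⟩
  countablyCompact := by
    refine ⟨?_⟩
    have h₁ : IsCountablyCompact (univ : Set (Σ i, X i)) := by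
      rw [← range_id, range_sigma_eq_iUnion_range]
      exact isCountablyCompact_iUnion fun i => image_univ ▸
        (hX i).isCountablyCompact_univ.image continuous_sigmaMk
    rw [← range_inl_union_range_inr, ← image_univ, ← image_univ]
    exact (h₁.image continuous_inl).union (isCompact_univ.isCountablyCompact.image continuous_inr)
  isEmbedding i := IsEmbedding.inl.comp IsEmbedding.sigmaMk
  isClopen_range i := by
    have : range (fun x : X i => (Sum.inl ⟨i, x⟩ : (Σ i, X i) ⊕ PUnit.{max u v + 1})) =
        Sum.inl '' range (Sigma.mk i) := (range_comp Sum.inl (Sigma.mk i))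
    rw [this]
    exact ⟨IsClosedEmbedding.inl.isClosedMap _ isClosed_range_sigmaMk,
      IsOpenEmbedding.inl.isOpenMap _ isOpen_range_sigmaMk⟩

theorem IsWeaklyNCCorsonCC.sigma {ι : Type v} [Finite ι] {X : ι → Type u}
    [∀ i, TopologicalSpace (X i)] (hX : ∀ i, IsWeaklyNCCorsonCC (X i)) :
    IsWeaklyNCCorsonCC (Σ i, X i) := by
  have := fun i => (hX i).t35
  have hZ := (isOnePointCCModification_sigma fun i =>
    (hX i).countablyCompact).isWeaklyNCCorsonCC hX
  have hS := hZ.subtype isClosed_range_inl.isCountablyClosed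
  exact hS.image (f := IsEmbedding.inl.toHomeomorph.symm) (Homeomorph.continuous _)
    (Homeomorph.surjective _)

theorem IsWeaklyNCCorsonCC.iUnion {ι : Type v} [Finite ι] {X : Type u} [TopologicalSpace X]
    [T35Space X] {S : ι → Set X} (hS : ∀ i, IsWeaklyNCCorsonCC (S i)) :
    IsWeaklyNCCorsonCC (⋃ i, S i : Set X) := by
  -- reindexing by `Fin n` keeps the topological sum in the universe of `X`
  obtain ⟨n, ⟨e⟩⟩ := Finite.exists_equiv_fin ι
  have h : IsWeaklyNCCorsonCC (Σ k : Fin n, S (e.symm k)) := .sigma fun k => hS _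
  refine h.image (f := fun x => ⟨x.2.1, mem_iUnion.2 ⟨_, x.2.2⟩⟩)
    (continuous_sigma fun k => continuous_subtype_val.subtype_mk _) ?_
  rintro ⟨x, hx⟩
  obtain ⟨i, hi⟩ := mem_iUnion.1 hx
  exact ⟨⟨e i, x, by rwa [e.symm_apply_apply]⟩, rfl⟩

theorem mainTheorem2 :
    -- countably closed subspaces
    (∀ (X : Type u) [TopologicalSpace X] (S : Set X),
      IsWeaklyNCCorsonCC X → IsCountablyClosed S → IsWeaklyNCCorsonCC S) ∧
    -- countable products
    (∀ (ι : Type v) [Countable ι] (X : ι → Type u) [∀ i, TopologicalSpace (X i)],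
      (∀ i, IsWeaklyNCCorsonCC (X i)) → IsWeaklyNCCorsonCC (∀ i, X i)) ∧
    -- continuous images
    (∀ (X Z : Type u) [TopologicalSpace X] [TopologicalSpace Z] [T35Space Z] (f : X → Z),
      IsWeaklyNCCorsonCC X → Continuous f → Function.Surjective f → IsWeaklyNCCorsonCC Z) ∧
    -- finite unions
    (∀ (ι : Type v) [Finite ι] (X : Type u) [TopologicalSpace X] [T35Space X] (S : ι → Set X),
      (∀ i, IsWeaklyNCCorsonCC (S i)) → IsWeaklyNCCorsonCC (⋃ i, S i : Set X)) ∧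
    -- finite topological sums
    (∀ (ι : Type v) [Finite ι] (X : ι → Type u) [∀ i, TopologicalSpace (X i)],
      (∀ i, IsWeaklyNCCorsonCC (X i)) → IsWeaklyNCCorsonCC (Σ i, X i)) ∧
    -- one-point countably compact modifications of topological sums
    (∀ (A : Type v) (X : A → Type u) [∀ a, TopologicalSpace (X a)]
      (Z : Type (max u v)) [TopologicalSpace Z] [T35Space Z] (i : ∀ a, X a → Z) (p : Z),
      (∀ a, IsWeaklyNCCorsonCC (X a)) → IsOnePointCCModification X Z i p →
        IsWeaklyNCCorsonCC Z) :=
  ⟨fun _ _ _ hX hS => hX.subtype hS, fun _ _ _ _ hX => .pi hX,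
    fun _ _ _ _ _ _ hX hf hs => hX.image hf hs, fun _ _ _ _ _ _ hS => .iUnion hS,
    fun _ _ _ _ hX => .sigma hX, fun _ _ _ _ _ _ _ _ hX h => h.isWeaklyNCCorsonCC hX⟩
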